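/- Let $\mathbb{K}$ be a field, let $G$ be a finite simple graph with vertex set $V(G)=\{v_1,\dots,v_n\}$, let $S=\mathbb{K}[x_1,\dots,x_n]$, and let $I=I(G)\subseteq S$ be the edge ideal of $G$, generated by the monomials $x_ix_j$ with $\{v_i,v_j\}$ an edge of $G$. Let $p$ be the number of connected components of $G$ that are bipartite (isolated vertices count as bipartite components). Then for every integer $k\ge 0$, $$\operatorname{sdepth}(I^k/I^{k+1})\ge p .$$ Here, for a finitely generated $\mathbb{Z}^n$-graded $S$-module $M$, a Stanley decomposition of $M$ is a finite direct sum decomposition $\mathcal{D}: M=\bigoplus_{i=1}^r u_i\mathbb{K}[Z_i]$ of $M$ as a $\mathbb{K}$-vector space, where each $u_i\in M$ is homogeneous, $Z_i\subseteq\{x_1,\dots,x_n\}$, and $u_i\mathbb{K}[Z_i]$ is a free $\mathbb{K}[Z_i]$-module with basis $u_i$; one sets $\operatorname{sdepth}(\mathcal{D})=\min_i|Z_i|$ and $\operatorname{sdepth}(M)=\max_{\mathcal{D}}\operatorname{sdepth}(\mathcal{D})$, with $\operatorname{sdepth}(0)=\infty$. The module $I^k/I^{k+1}$ carries the $\mathbb{Z}^n$-grading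 inherited from $S$. -/

import Mathlib

open MvPolynomial

noncomputable section

section Stanley

variable {σ K M : Type*} [Field K] [AddCommGroup M] [Module K M] [Module (MvPolynomial σ K) M]
  [IsScalarTower K (MvPolynomial σ K) M]

/-- The `K`-subspace `u K[Z]` of an `S`-module `M`, where `S = K[x_i : i ∈ σ]`, `u ∈ M` and `Z` is
a set of variables: all products of `u` with a polynomial in the variables of `Z` only. -/
def stanleySpace (u : M) (Z : Finset σ) : Submodule K M :=
  (Subalgebra.toSubmodule (supported K (Z : Set σ))).map
    ((LinearMap.toSpanSingleton (MvPolynomial σ K) M u).restrictScalars K)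

/-- A Stanley decomposition of a `ℤ^n`-graded module `M` over the polynomial ring
`S = K[x_i : i ∈ σ]`; here `𝓜 a` is the homogeneous component of `M` of multidegree `a`. It is a
finite direct sum decomposition of the `K`-space `M` into Stanley spaces `u K[Z]`, with `u`
homogeneous and `u K[Z]` free over `K[Z]` (on the generator `u`). -/
structure StanleyDecomposition (𝓜 : (σ →₀ ℤ) → Submodule K M) where
  /-- the number of summands -/
  r : ℕ
  /-- the generators -/
  u : Fin r → M
  /-- the sets of variables -/
  Z : Fin r → Finset σ
  homogeneous : ∀ i, ∃ a, u i ∈ 𝓜 a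
  free : ∀ i, ∀ f ∈ supported K (Z i : Set σ), f • u i = 0 → f = 0
  isInternal : DirectSum.IsInternal fun i => stanleySpace (K := K) (u i) (Z i)

/-- The Stanley depth of a Stanley decomposition: the minimum of the dimensions `|Z i|`
(`⊤` for the empty decomposition, which occurs only for the zero module). -/
def StanleyDecomposition.sdepth {𝓜 : (σ →₀ ℤ) → Submodule K M}
    (D : StanleyDecomposition 𝓜) : ℕ∞ :=
  ⨅ i, ((D.Z i).card : ℕ∞)

/-- The Stanley depth of a `ℤ^n`-graded module: the maximum of the Stanley depths of its Stanley
decompositions (`⊤` for the zero module). -/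
def sdepth (𝓜 : (σ →₀ ℤ) → Submodule K M) : ℕ∞ :=
  ⨆ D : StanleyDecomposition 𝓜, D.sdepth

end Stanley

section EdgeIdeal

variable {V : Type*}

/-- The edge ideal of a graph `G`, generated by the monomials `x_v x_w` for the edges `vw`. -/
def edgeIdeal (K : Type*) [Field K] (G : SimpleGraph V) : Ideal (MvPolynomial V K) :=
  Ideal.span {f | ∃ v w, G.Adj v w ∧ f = X v * X w}

/-- The number of connected components of `G` that are bipartite graphs
(a single vertex is a bipartite graph). -/
def numBipartiteComponents (G : SimpleGraph V) : ℕ :=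
  Nat.card {C : G.ConnectedComponent // C.toSimpleGraph.IsBipartite}

variable {K : Type*} [Field K]

/-- For ideals `L ⊆ J`, the module `J / L`. -/
abbrev IdealQuot (J L : Ideal (MvPolynomial V K)) : Type _ :=
  J ⧸ Submodule.comap J.subtype L

/-- The multigrading of `J / L` inherited from the polynomial ring: the component of degree `a`
consists of the classes of the elements of `J` that are homogeneous of multidegree `a`, where the
variable `x_v` has multidegree the unit vector at `v`. -/
def quotGrading (J L : Ideal (MvPolynomial V K)) (a : V →₀ ℤ) :
    Submodule K (IdealQuot J L) :=
  ((weightedHomogeneousSubmodule K (fun v : V => Finsupp.single v (1 : ℤ)) a).comap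
    (J.subtype.restrictScalars K)).map ((Submodule.comap J.subtype L).mkQ.restrictScalars K)

end EdgeIdeal

end

/-! The classes of the monomials x^a with `edgeOrder` exactly k form a K-basis of I^k/I^{k+1}. So it
suffices to split this set of exponents into finitely many disjoint boxes, each with at least p free
directions (`le_sdepth_of_boxPartition`). The order is additive over connected components
(`edgeOrder_union`), and free directions add up in products of boxes (`BoxPartition.inter`). Hence
one free direction per bipartite component, and none elsewhere, is enough.

On a bipartite component, weighted König duality makes the order of x^a equal to the least weight of
a vertex cover. Some optimal cover misses a vertex, and raising the exponent there leaves the order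
unchanged (`exists_edgeOrder_add_single`). The level sets of the order are convex and depend only on
the exponents truncated at k+1. Such a set, with an unbounded direction at every point, splits into
boxes that each have a free direction (`DeterminedBy.boxPartition_one`). -/

/-! ### Partitions of sets of exponents into boxes -/

section BoxPartition

variable {V : Type*}

/-- The exponent vectors that lie, in the coordinates of `C`, in the box with corner `u` and free
directions `Z`; the coordinates outside `C` are arbitrary. -/
def cylBox (C : Finset V) (u : V → ℕ) (Z : Finset V) : Set (V →₀ ℕ) :=
  {a | ∀ v ∈ C, u v ≤ a v ∧ (v ∉ Z → a v = u v)}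

/-- `BoxPartition C d A` says that `A` is a disjoint union of finitely many boxes in the coordinates
of `C`, each with at least `d` free directions. -/
inductive BoxPartition (C : Finset V) (d : ℕ) : Set (V →₀ ℕ) → Prop
  | empty : BoxPartition C d ∅
  | box (u : V → ℕ) (Z : Finset V) (hZ : Z ⊆ C) (hd : d ≤ Z.card) :
      BoxPartition C d (cylBox C u Z)
  | union {A B : Set (V →₀ ℕ)} (h : Disjoint A B) (hA : BoxPartition C d A)
      (hB : BoxPartition C d B) : BoxPartition C d (A ∪ B)

theorem cylBox_inter [DecidableEq V] {C C' : Finset V} (h : Disjoint C C') {Z Z' : Finset V} (hZ : Z ⊆ C)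
    (hZ' : Z' ⊆ C') (u u' : V → ℕ) :
    cylBox C u Z ∩ cylBox C' u' Z' =
      cylBox (C ∪ C') (fun v => if v ∈ C then u v else u' v) (Z ∪ Z') := by
  ext a
  simp only [cylBox, Set.mem_inter_iff, Set.mem_ofPred_eq, Finset.mem_union]
  have hd := Finset.disjoint_left.1 h
  constructor
  · rintro ⟨h1, h2⟩ v hv
    by_cases hC : v ∈ C
    · simp only [hC, if_true]
      exact ⟨(h1 v hC).1, fun hn => (h1 v hC).2 fun hz => hn (Or.inl hz)⟩
    · have hC' := hv.resolve_left hC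
      simp only [hC, if_false]
      exact ⟨(h2 v hC').1, fun hn => (h2 v hC').2 fun hz => hn (Or.inr hz)⟩
  · intro h1
    refine ⟨fun v hv => ?_, fun v hv => ?_⟩
    · have := h1 v (Or.inl hv)
      simp only [hv, if_true] at this
      exact ⟨this.1, fun hn => this.2 (not_or.2 ⟨hn, fun hz => hd hv (hZ' hz)⟩)⟩
    · have hC : v ∉ C := fun hc => hd hc hv
      have := h1 v (Or.inr hv)
      simp only [hC, if_false] at this
      exact ⟨this.1, fun hn => this.2 (not_or.2 ⟨fun hz => hC (hZ hz), hn⟩)⟩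

/-- Over disjoint coordinate sets the intersection of two cylinders is a product of boxes, so the
free directions add. This is how the components of the graph are combined. -/
theorem BoxPartition.inter [DecidableEq V] {C C' : Finset V} (h : Disjoint C C') {d d' : ℕ}
    {A B : Set (V →₀ ℕ)} (hA : BoxPartition C d A) (hB : BoxPartition C' d' B) :
    BoxPartition (C ∪ C') (d + d') (A ∩ B) := by
  induction hA with
  | empty => rw [Set.empty_inter]; exact .empty
  | union hd _ _ ih1 ih2 =>
    rw [Set.union_inter_distrib_right]
    exact .union (hd.mono Set.inter_subset_left Set.inter_subset_left) ih1 ih2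
  | box u Z hZ hdZ =>
    induction hB with
    | empty => rw [Set.inter_empty]; exact .empty
    | union hd _ _ ih1 ih2 =>
      rw [Set.inter_union_distrib_left]
      exact .union (hd.mono Set.inter_subset_right Set.inter_subset_right) ih1 ih2
    | box u' Z' hZ' hdZ' =>
      rw [cylBox_inter h hZ hZ']
      refine .box _ _ (Finset.union_subset_union hZ hZ') ?_
      rw [Finset.card_union_of_disjoint (h.mono hZ hZ')]
      omega

theorem BoxPartition.mono {C : Finset V} {d d' : ℕ} (h : d' ≤ d) {A : Set (V →₀ ℕ)}
    (hA : BoxPartition C d A) : BoxPartition C d' A := by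
  induction hA with
  | empty => exact .empty
  | box u Z hZ hd => exact .box u Z hZ (h.trans hd)
  | union hd _ _ ih1 ih2 => exact .union hd ih1 ih2

theorem BoxPartition.biUnion {ι : Type*} {C : Finset V} {d : ℕ} (s : Finset ι)
    (f : ι → Set (V →₀ ℕ)) (hf : ∀ i ∈ s, BoxPartition C d (f i))
    (hd : ∀ i ∈ s, ∀ j ∈ s, i ≠ j → Disjoint (f i) (f j)) :
    BoxPartition C d (⋃ i ∈ s, f i) := by
  classical
  induction s using Finset.induction_on with
  | empty => simpa using BoxPartition.empty
  | insert i s hi ih =>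
    rw [Finset.set_biUnion_insert]
    refine .union ?_ (hf i (by simp)) (ih (fun j hj => hf j (by simp [hj]))
      fun j hj l hl => hd j (by simp [hj]) l (by simp [hl]))
    simp only [Set.disjoint_iUnion_right]
    intro j hj
    exact hd i (by simp) j (by simp [hj]) (by rintro rfl; exact hi hj)

theorem boxPartition_eq (v : V) (j : ℕ) : BoxPartition {v} 0 {a : V →₀ ℕ | a v = j} := by
  have : {a : V →₀ ℕ | a v = j} = cylBox {v} (fun _ => j) ∅ := by
    ext a
    simp only [cylBox, Set.mem_ofPred_eq, Finset.mem_singleton, forall_eq, Finset.notMem_empty,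
      not_false_eq_true, true_imp_iff]
    omega
  rw [this]
  exact .box _ _ (by simp) (by simp)

theorem boxPartition_ge (v : V) (j : ℕ) : BoxPartition {v} 1 {a : V →₀ ℕ | j ≤ a v} := by
  have : {a : V →₀ ℕ | j ≤ a v} = cylBox {v} (fun _ => j) {v} := by
    ext a
    simp [cylBox]
  rw [this]
  exact .box _ _ (by simp) (by simp)

/-- Membership in `A` depends only on the coordinates in `C`, truncated at `N`. -/
def DeterminedBy (C : Finset V) (N : ℕ) (A : Set (V →₀ ℕ)) : Prop :=
  ∀ ⦃a b : V →₀ ℕ⦄, (∀ v ∈ C, min (a v) N = min (b v) N) → a ∈ A → b ∈ A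

theorem DeterminedBy.mem_iff {C : Finset V} {N : ℕ} {A : Set (V →₀ ℕ)} (h : DeterminedBy C N A)
    {a b : V →₀ ℕ} (hab : ∀ v ∈ C, min (a v) N = min (b v) N) : a ∈ A ↔ b ∈ A :=
  ⟨h hab, h fun v hv => (hab v hv).symm⟩

theorem DeterminedBy.diff {C : Finset V} {N : ℕ} {A B : Set (V →₀ ℕ)} (hA : DeterminedBy C N A)
    (hB : DeterminedBy C N B) : DeterminedBy C N (A \ B) :=
  fun _ _ hab h => ⟨hA hab h.1, fun hb => h.2 (hB (fun v hv => (hab v hv).symm) hb)⟩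

/-- The slice of `A` on which the coordinate `v` equals `j`, as a cylinder over the other
coordinates. -/
def slice (A : Set (V →₀ ℕ)) (v : V) (j : ℕ) : Set (V →₀ ℕ) := {a | a.update v j ∈ A}

theorem DeterminedBy.slice [DecidableEq V] {C : Finset V} {N : ℕ} {A : Set (V →₀ ℕ)} {v : V}
    (h : DeterminedBy (insert v C) N A) (j : ℕ) : DeterminedBy C N (slice A v j) := by
  intro a b hab ha
  refine h (fun w hw => ?_) ha
  by_cases hwv : w = v
  · subst hwv; simp
  · simp only [Finsupp.coe_update, Function.update_of_ne hwv]
    exact hab w (Finset.mem_of_mem_insert_of_ne hw hwv)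

theorem mem_slice_self (A : Set (V →₀ ℕ)) (v : V) (a : V →₀ ℕ) : a ∈ slice A v (a v) ↔ a ∈ A := by
  simp [slice]

theorem DeterminedBy.mem_slice_of_le [DecidableEq V] {C : Finset V} {N : ℕ} {A : Set (V →₀ ℕ)} {v : V}
    (h : DeterminedBy (insert v C) N A) {a : V →₀ ℕ} (ha : N ≤ a v) :
    a ∈ _root_.slice A v N ↔ a ∈ A := by
  refine h.mem_iff fun w _ => ?_
  by_cases hwv : w = v
  · subst hwv; simp [ha]
  · simp [Function.update_of_ne hwv]

/-- Slice along one coordinate `v`: the finitely many values below `N` are treated separately, and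
from `N` on membership no longer depends on `v`. -/
theorem DeterminedBy.boxPartition_zero [DecidableEq V] {C : Finset V} {N : ℕ} {A : Set (V →₀ ℕ)}
    (h : DeterminedBy C N A) : BoxPartition C 0 A := by
  induction C using Finset.induction_on generalizing A with
  | empty =>
    rcases A.eq_empty_or_nonempty with rfl | ⟨a, ha⟩
    · exact .empty
    · have : A = cylBox ∅ 0 ∅ := by
        ext b
        simpa [cylBox] using h (a := a) (b := b) (by simp) ha
      rw [this]
      exact .box _ _ (by simp) (by simp)
  | insert v C hv ih =>
    have hd : Disjoint C {v} := by simpa using hv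
    have key : A = (⋃ j ∈ Finset.range N, _root_.slice A v j ∩ {a | a v = j}) ∪
        (_root_.slice A v N ∩ {a | N ≤ a v}) := by
      ext a
      simp only [Set.mem_union, Set.mem_iUnion, Set.mem_inter_iff, Set.mem_ofPred_eq,
        Finset.mem_range, exists_prop]
      rcases lt_or_ge (a v) N with hlt | hge
      · rw [← mem_slice_self A v a]
        constructor
        · exact fun ha => Or.inl ⟨_, hlt, ha, rfl⟩
        · rintro (⟨j, _, ha, rfl⟩ | ⟨_, h2⟩)
          · exact ha
          · omega
      · rw [h.mem_slice_of_le hge]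
        constructor
        · exact fun ha => Or.inr ⟨ha, hge⟩
        · rintro (⟨j, _, _, rfl⟩ | ⟨h1, _⟩)
          · omega
          · exact h1
    rw [key, show insert v C = C ∪ {v} by ext; simp]
    refine .union ?_ (.biUnion _ _ (fun j _ => ?_) fun i _ j _ hij => ?_) ?_
    · simp only [Set.disjoint_iUnion_left, Finset.mem_range]
      intro j hj
      refine Set.disjoint_left.2 fun a ha hb => ?_
      have h1 : a v = j := ha.2
      have h2 : N ≤ a v := hb.2
      omega
    · exact (ih (h.slice j)).inter hd (boxPartition_eq v j)
    · exact Set.disjoint_left.2 fun a ha hb => hij (ha.2.symm.trans hb.2)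
    · exact ((ih (h.slice N)).inter hd (boxPartition_ge v N)).mono (by simp)

/-- A convex set of exponents all of whose elements have an unbounded direction is a disjoint union
of boxes with at least one free direction. -/
theorem DeterminedBy.boxPartition_one [DecidableEq V] {C : Finset V} {N : ℕ} {A : Set (V →₀ ℕ)}
    (h : DeterminedBy C N A) (hc : A.OrdConnected)
    (hdir : ∀ a ∈ A, ∃ i ∈ C, a + Finsupp.single i N ∈ A) : BoxPartition C 1 A := by
  induction C using Finset.induction_on generalizing A with
  | empty =>
    rcases A.eq_empty_or_nonempty with rfl | ⟨a, ha⟩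
    · exact .empty
    · obtain ⟨i, hi, _⟩ := hdir a ha
      simp at hi
  | insert v C hv ih =>
    have hd : Disjoint C {v} := by simpa using hv
    have upd_add : ∀ (a : V →₀ ℕ) (j : ℕ), ∀ i ∈ C,
        (a + Finsupp.single i N).update v j = a.update v j + Finsupp.single i N := by
      intro a j i hi
      have hiv : i ≠ v := by rintro rfl; exact hv hi
      ext w
      by_cases hw : w = v
      · subst hw; simp [hiv]
      · simp [Function.update_of_ne hw]
    have upd_mono : ∀ {a b : V →₀ ℕ} {i j : ℕ}, a ≤ b → i ≤ j → a.update v i ≤ b.update v j := by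
      intro a b i j hab hij w
      by_cases hw : w = v
      · subst hw; simpa using hij
      · simpa [Function.update_of_ne hw] using hab w
    -- the elements of a slice without unbounded direction inside the slice
    let F : ℕ → Set (V →₀ ℕ) := fun j =>
      {a | a ∈ _root_.slice A v j ∧ ∀ i ∈ C, a + Finsupp.single i N ∉ _root_.slice A v j}
    have hF : ∀ j, DeterminedBy C N (F j) := by
      intro j a b hab ha
      refine ⟨(h.slice j) hab ha.1, fun i hi hb => ha.2 i hi ((h.slice j) (fun w hw => ?_) hb)⟩
      have := hab w hw
      simp only [Finsupp.coe_add, Pi.add_apply]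
      omega
    -- A point of `F i` can only be unbounded in direction `v`, so raising `v` by `N` stays in `A`,
    -- and by convexity so does raising it to `j`. An unbounded direction in slice `j` would, again
    -- by convexity, be one in slice `i`.
    have hFup : ∀ {i j : ℕ}, i ≤ j → j ≤ N → F i ⊆ F j := by
      intro i j hij hjN a ha
      obtain ⟨l, hl, hlA⟩ := hdir _ ha.1
      have hlv : l = v := by
        by_contra hne
        have hlC := Finset.mem_of_mem_insert_of_ne hl hne
        exact ha.2 l hlC (by simpa [_root_.slice, upd_add a i l hlC] using hlA)
      subst hlv
      refine ⟨hc.out ha.1 hlA ⟨upd_mono le_rfl hij, fun w => ?_⟩, fun m hm hmem => ha.2 m hm ?_⟩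
      · by_cases hw : w = l
        · subst hw; simp; omega
        · simp [Function.update_of_ne hw]
      · exact hc.out ha.1 hmem ⟨upd_mono (by simp) le_rfl, upd_mono le_rfl hij⟩
    have hR : ∀ j, BoxPartition C 1 (_root_.slice A v j \ F j) := by
      intro j
      have hex : ∀ a ∈ _root_.slice A v j \ F j,
          ∃ i ∈ C, a + Finsupp.single i N ∈ _root_.slice A v j := by
        intro a ha
        by_contra hcon
        push Not at hcon
        exact ha.2 ⟨ha.1, hcon⟩
      -- Convexity survives the removal of `F j`: an unbounded direction of the upper endpoint
      -- serves every point in between.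
      refine ih ((h.slice j).diff (hF j)) ⟨?_⟩ ?_
      · intro a ha c hcc b hb
        have hbA : b ∈ _root_.slice A v j :=
          hc.out ha.1 hcc.1 ⟨upd_mono hb.1 le_rfl, upd_mono hb.2 le_rfl⟩
        obtain ⟨i, hi, hiA⟩ := hex c hcc
        refine ⟨hbA, fun hbF => hbF.2 i hi ?_⟩
        exact hc.out ha.1 hiA ⟨upd_mono (hb.1.trans (by simp)) le_rfl,
          upd_mono (by gcongr; exact hb.2) le_rfl⟩
      · intro a ha
        obtain ⟨i, hi, hiA⟩ := hex a ha
        -- After truncation at `N`, adding `N` twice is the same as adding it once, so the shifted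
        -- point still has the direction `i`.
        refine ⟨i, hi, hiA, fun hbF => hbF.2 i hi ((h.slice j) (fun w hw => ?_) hiA)⟩
        simp only [Finsupp.coe_add, Pi.add_apply, Finsupp.single_apply]
        split_ifs <;> omega
    -- `F j` without the elements that occur in an earlier `F i`
    let E : ℕ → Set (V →₀ ℕ) := fun j => if j = 0 then F 0 else F j \ F (j - 1)
    have hE : ∀ j, DeterminedBy C N (E j) := by
      intro j
      by_cases hj : j = 0
      · simpa [E, hj] using hF 0
      · simpa [E, hj] using (hF j).diff (hF (j - 1))
    have hEF : ∀ j, E j ⊆ F j := by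
      intro j a ha
      by_cases hj : j = 0
      · simpa [E, hj] using ha
      · simp only [E, hj, if_false] at ha
        exact ha.1
    have hEnot : ∀ {i j : ℕ}, i < j → j ≤ N → ∀ a ∈ E j, a ∉ F i := by
      intro i j hij hjN a ha hai
      have hj : j ≠ 0 := by omega
      simp only [E, hj, if_false] at ha
      exact ha.2 (hFup (by omega) (by omega) hai)
    have hFE : ∀ j, ∀ a ∈ F j, ∃ i ≤ j, a ∈ E i := by
      intro j
      induction j with
      | zero => exact fun a ha => ⟨0, le_rfl, by simpa [E] using ha⟩
      | succ j ihj =>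
        intro a ha
        by_cases haj : a ∈ F j
        · obtain ⟨i, hi, hai⟩ := ihj a haj
          exact ⟨i, by omega, hai⟩
        · exact ⟨j + 1, le_rfl, by simpa [E] using ⟨ha, haj⟩⟩
    have hEdisj : ∀ i ≤ N, ∀ j ≤ N, i ≠ j → Disjoint (E i) (E j) := by
      intro i hi j hj hij
      refine Set.disjoint_left.2 fun a hai haj => ?_
      rcases lt_or_gt_of_ne hij with hlt | hlt
      · exact hEnot hlt hj a haj (hEF i hai)
      · exact hEnot hlt hi a hai (hEF j haj)
    -- Points outside `F` get their free direction from the induction hypothesis, or from `v` in the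
    -- tail. Since `F` increases, a point of `F` belongs to `E i` for some `i` up to its
    -- `v`-coordinate, and `E i` times the ray from `i` is free in `v`.
    have key : A = ((⋃ j ∈ Finset.range N, (_root_.slice A v j \ F j) ∩ {a | a v = j}) ∪
        ((_root_.slice A v N \ F N) ∩ {a | N ≤ a v})) ∪
        (⋃ j ∈ Finset.range (N + 1), E j ∩ {a | j ≤ a v}) := by
      ext a
      simp only [Set.mem_union, Set.mem_iUnion, Set.mem_inter_iff, Set.mem_ofPred_eq,
        Finset.mem_range, exists_prop, Set.mem_sdiff]
      constructor
      · intro ha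
        rcases lt_or_ge (a v) N with hlt | hge
        · have hs := (mem_slice_self A v a).2 ha
          by_cases haF : a ∈ F (a v)
          · obtain ⟨i, hi, hai⟩ := hFE _ a haF
            exact Or.inr ⟨i, by omega, hai, hi⟩
          · exact Or.inl (Or.inl ⟨_, hlt, ⟨hs, haF⟩, rfl⟩)
        · have hs := (h.mem_slice_of_le hge).2 ha
          by_cases haF : a ∈ F N
          · obtain ⟨i, hi, hai⟩ := hFE _ a haF
            exact Or.inr ⟨i, by omega, hai, by omega⟩
          · exact Or.inl (Or.inr ⟨⟨hs, haF⟩, hge⟩)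
      · rintro ((⟨j, _, ha, rfl⟩ | ⟨ha, hge⟩) | ⟨j, hj, ha, hja⟩)
        · exact (mem_slice_self A v a).1 ha.1
        · exact (h.mem_slice_of_le hge).1 ha.1
        · rcases le_total (a v) N with hle | hge
          · exact (mem_slice_self A v a).1 (hFup hja hle (hEF j ha)).1
          · exact (h.mem_slice_of_le hge).1 (hFup (by omega) le_rfl (hEF j ha)).1
    rw [key, show insert v C = C ∪ {v} by ext; simp]
    refine .union ?_ (.union ?_ (.biUnion _ _ (fun j _ => ?_) fun i _ j _ hij => ?_) ?_)
      (.biUnion _ _ (fun j _ => ?_) fun i hi j hj hij => ?_)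
    · refine Set.disjoint_left.2 fun a ha hb => ?_
      simp only [Set.mem_union, Set.mem_iUnion, Set.mem_inter_iff, Set.mem_ofPred_eq,
        Finset.mem_range, exists_prop, Set.mem_sdiff] at ha hb
      obtain ⟨i, hi, hai, hiv⟩ := hb
      rcases ha with ⟨j, hj, ha, rfl⟩ | ⟨ha, hge⟩
      · exact ha.2 (hFup hiv hj.le (hEF i hai))
      · exact ha.2 (hFup (by omega) le_rfl (hEF i hai))
    · refine Set.disjoint_left.2 fun a ha hb => ?_
      simp only [Set.mem_iUnion, Set.mem_inter_iff, Set.mem_ofPred_eq,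
        Finset.mem_range, exists_prop] at ha hb
      obtain ⟨j, hj, _, hja⟩ := ha
      have := hb.2
      omega
    · exact (hR j).inter hd (boxPartition_eq v j)
    · exact Set.disjoint_left.2 fun a ha hb => hij (ha.2.symm.trans hb.2)
    · simpa using ((h.slice N).diff (hF N)).boxPartition_zero.inter hd (boxPartition_ge v N)
    · simpa using (hE j).boxPartition_zero.inter hd (boxPartition_ge v j)
    · simp only [Finset.mem_range] at hi hj
      exact (hEdisj i (by omega) j (by omega) hij).mono Set.inter_subset_left Set.inter_subset_left

/-- The boxes of a partition, listed. -/
theorem BoxPartition.exists_boxes [Fintype V] {d : ℕ} {A : Set (V →₀ ℕ)}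
    (hA : BoxPartition Finset.univ d A) :
    ∃ (r : ℕ) (u : Fin r → V →₀ ℕ) (Z : Fin r → Finset V), (∀ i, d ≤ (Z i).card) ∧
      (∀ i, ∀ b : V →₀ ℕ, b.support ⊆ Z i → u i + b ∈ A) ∧
      (∀ a ∈ A, ∃ i, ∃ b : V →₀ ℕ, b.support ⊆ Z i ∧ a = u i + b) ∧
      (∀ i j, ∀ b c : V →₀ ℕ, b.support ⊆ Z i → c.support ⊆ Z j → u i + b = u j + c → i = j) := by
  induction hA with
  | empty => exact ⟨0, Fin.elim0, Fin.elim0, by simp⟩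
  | box u Z _ hd =>
    let u' : V →₀ ℕ := Finsupp.equivFunOnFinite.symm u
    refine ⟨1, fun _ => u', fun _ => Z, fun _ => hd, ?_, ?_, fun i j _ _ _ _ _ =>
      Subsingleton.elim i j⟩
    · intro _ b hb v _
      refine ⟨by simp [u'], fun hv => ?_⟩
      have : b v = 0 := by
        by_contra hne
        exact hv (hb (by simpa using hne))
      simp [u', this]
    · intro a ha
      refine ⟨0, a - u', fun v hv => ?_, ?_⟩
      · by_contra hvZ
        have := (ha v (Finset.mem_univ v)).2 hvZ
        simp [u', this] at hv
      · ext v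
        have := (ha v (Finset.mem_univ v)).1
        simp [u']
        omega
  | @union A B hdisj _ _ ihA ihB =>
    obtain ⟨r, u, Z, h1, h2, h3, h4⟩ := ihA
    obtain ⟨r', u', Z', h1', h2', h3', h4'⟩ := ihB
    have hno := Set.disjoint_left.1 hdisj
    refine ⟨r + r', Fin.append u u', Fin.append Z Z', ?_, ?_, ?_, ?_⟩
    · intro i
      refine Fin.addCases (fun i => ?_) (fun i => ?_) i
      · simpa using h1 i
      · simpa using h1' i
    · intro i
      refine Fin.addCases (fun i => ?_) (fun i => ?_) i
      · simpa using fun b hb => Or.inl (h2 i b hb)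
      · simpa using fun b hb => Or.inr (h2' i b hb)
    · rintro a (ha | ha)
      · obtain ⟨i, b, hb, rfl⟩ := h3 a ha
        exact ⟨Fin.castAdd r' i, b, by simpa using hb, by simp⟩
      · obtain ⟨i, b, hb, rfl⟩ := h3' a ha
        exact ⟨Fin.natAdd r i, b, by simpa using hb, by simp⟩
    · intro i j
      refine Fin.addCases (fun i => ?_) (fun i => ?_) i <;>
      refine Fin.addCases (fun j => ?_) (fun j => ?_) j <;>
      intro b c hb hc heq <;>
      simp only [Fin.append_left, Fin.append_right] at hb hc heq
      · rw [h4 i j b c hb hc heq]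
      · exact (hno (h2 i b hb) (heq ▸ h2' j c hc)).elim
      · exact (hno (h2 j c hc) (heq ▸ h2' i b hb)).elim
      · rw [h4' i j b c hb hc heq]

end BoxPartition
open scoped Pointwise

/-! ### The order of a monomial with respect to powers of the edge ideal -/

section EdgePowers

variable {V : Type*}

/-- The exponents of the monomials `x_v x_w` for the edges `vw` of `G` inside `S`. -/
def edgeExponents (G : SimpleGraph V) (S : Set V) : Set (V →₀ ℕ) :=
  {e | ∃ v w, G.Adj v w ∧ v ∈ S ∧ w ∈ S ∧ e = Finsupp.single v 1 + Finsupp.single w 1}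

/-- The exponents of the monomials divisible by a product of `k` edges of `G` inside `S`. -/
def edgePower (G : SimpleGraph V) (S : Set V) (k : ℕ) : Set (V →₀ ℕ) :=
  {a | ∃ m ∈ k • edgeExponents G S, m ≤ a}

/-- The largest number of edges of `G` inside `S` whose product divides `x^a`. -/
noncomputable def edgeOrder (G : SimpleGraph V) (S : Set V) (a : V →₀ ℕ) : ℕ :=
  sSup {k | a ∈ edgePower G S k}

variable {G : SimpleGraph V} {S : Set V}

theorem mem_succ_nsmul {E : Set (V →₀ ℕ)} {k : ℕ} {m : V →₀ ℕ} :
    m ∈ (k + 1) • E ↔ ∃ m' ∈ k • E, ∃ e ∈ E, m' + e = m := by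
  rw [succ_nsmul, Set.mem_add]

/-- A simple graph has no loops, so each of the `k` edges contributes at most one to the exponent of
`v`. This is why exponents may be truncated at `k`. -/
theorem le_apply_of_mem_nsmul {k : ℕ} {m : V →₀ ℕ} (hm : m ∈ k • edgeExponents G S) (v : V) :
    m v ≤ k ∧ (v ∉ S → m v = 0) := by
  classical
  induction k generalizing m with
  | zero =>
    obtain rfl : m = 0 := by simpa using hm
    simp
  | succ k ih =>
    obtain ⟨m', hm', _, ⟨x, y, hxy, hx, hy, rfl⟩, rfl⟩ := mem_succ_nsmul.1 hm
    obtain ⟨h1, h2⟩ := ih hm'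
    have hne := hxy.ne
    simp only [Finsupp.coe_add, Pi.add_apply, Finsupp.single_apply]
    refine ⟨?_, fun hv => ?_⟩
    · by_cases h : x = v
      · have : y ≠ v := fun h' => hne (h.trans h'.symm)
        simp only [h, this, if_true, if_false]
        omega
      · simp only [h, if_false]
        split_ifs <;> omega
    · have hxv : x ≠ v := by rintro rfl; exact hv hx
      have hyv : y ≠ v := by rintro rfl; exact hv hy
      simp [hxv, hyv, h2 hv]

theorem le_degree_of_mem_nsmul {k : ℕ} {m : V →₀ ℕ} (hm : m ∈ k • edgeExponents G S) :
    k ≤ m.degree := by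
  induction k generalizing m with
  | zero => simp
  | succ k ih =>
    obtain ⟨m', hm', _, ⟨x, y, _, _, _, rfl⟩, rfl⟩ := mem_succ_nsmul.1 hm
    have := ih hm'
    simp only [map_add, Finsupp.degree_single]
    omega

theorem isUpperSet_edgePower (k : ℕ) : IsUpperSet (edgePower G S k) :=
  fun _ _ hab ⟨m, hm, hma⟩ => ⟨m, hm, hma.trans hab⟩

theorem edgePower_zero : edgePower G S 0 = Set.univ := by
  ext a
  simp [edgePower]

theorem edgePower_succ_subset (k : ℕ) : edgePower G S (k + 1) ⊆ edgePower G S k := by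
  rintro a ⟨m, hm, hma⟩
  obtain ⟨m', hm', e, _, rfl⟩ := mem_succ_nsmul.1 hm
  exact ⟨m', hm', le_trans (by simp) hma⟩

/-- The degree bounds the number of edge factors, so the supremum is attained, and the sets
`edgePower` decrease in `k`. -/
theorem mem_edgePower_iff {a : V →₀ ℕ} {k : ℕ} : a ∈ edgePower G S k ↔ k ≤ edgeOrder G S a := by
  have hb : BddAbove {k | a ∈ edgePower G S k} := by
    refine ⟨a.degree, ?_⟩
    rintro k ⟨m, hm, hma⟩
    exact (le_degree_of_mem_nsmul hm).trans (Finsupp.degree_mono hma)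
  have hne : {k | a ∈ edgePower G S k}.Nonempty := ⟨0, by simp [edgePower_zero]⟩
  exact ⟨fun h => le_csSup hb h, fun h => antitone_nat_of_succ_le
    (f := fun k => edgePower G S k) edgePower_succ_subset h (Nat.sSup_mem hne hb)⟩

theorem edgeOrder_eq_iff {a : V →₀ ℕ} {k : ℕ} :
    edgeOrder G S a = k ↔ a ∈ edgePower G S k \ edgePower G S (k + 1) := by
  rw [Set.mem_sdiff, mem_edgePower_iff, mem_edgePower_iff]
  omega

theorem edgePower_determinedBy {C : Finset V} {k N : ℕ} (hN : k ≤ N) :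
    DeterminedBy C N (edgePower G (C : Set V) k) := by
  rintro a b hab ⟨m, hm, hma⟩
  refine ⟨m, hm, fun v => ?_⟩
  obtain ⟨h1, h2⟩ := le_apply_of_mem_nsmul hm v
  by_cases hv : v ∈ C
  · have := hab v hv
    have := hma v
    omega
  · simp [h2 (by simpa using hv)]

theorem edgeOrder_determinedBy {C : Finset V} (k : ℕ) :
    DeterminedBy C (k + 1) {a | edgeOrder G (C : Set V) a = k} := by
  simp only [edgeOrder_eq_iff]
  exact (edgePower_determinedBy (Nat.le_succ k)).diff (edgePower_determinedBy le_rfl)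

/-- A difference of two upper sets is convex. -/
theorem ordConnected_edgeOrder (k : ℕ) : {a | edgeOrder G S a = k}.OrdConnected := by
  simp only [edgeOrder_eq_iff]
  exact ⟨fun a ha c hc b hb => ⟨isUpperSet_edgePower k hb.1 ha.1,
    fun h => hc.2 (isUpperSet_edgePower (k + 1) hb.2 h)⟩⟩

theorem mem_nsmul_union {E E' : Set (V →₀ ℕ)} {k : ℕ} {m : V →₀ ℕ} :
    m ∈ k • (E ∪ E') ↔ ∃ i j, i + j = k ∧ ∃ m₁ ∈ i • E, ∃ m₂ ∈ j • E', m₁ + m₂ = m := by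
  induction k generalizing m with
  | zero =>
    constructor
    · intro hm
      exact ⟨0, 0, rfl, 0, by simp, 0, by simp, by simpa [eq_comm] using hm⟩
    · rintro ⟨i, j, hij, m₁, h1, m₂, h2, rfl⟩
      obtain ⟨rfl, rfl⟩ : i = 0 ∧ j = 0 := by omega
      simp only [zero_nsmul, Set.mem_zero] at *
      simp [h1, h2]
  | succ k ih =>
    rw [mem_succ_nsmul]
    constructor
    · rintro ⟨m', hm', e, he, rfl⟩
      obtain ⟨i, j, rfl, m₁, h1, m₂, h2, rfl⟩ := ih.1 hm'
      rcases he with he | he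
      · exact ⟨i + 1, j, by omega, m₁ + e, mem_succ_nsmul.2 ⟨_, h1, _, he, rfl⟩, m₂, h2, by abel⟩
      · exact ⟨i, j + 1, by omega, m₁, h1, m₂ + e, mem_succ_nsmul.2 ⟨_, h2, _, he, rfl⟩, by abel⟩
    · rintro ⟨i, j, hij, m₁, h1, m₂, h2, rfl⟩
      rcases i with _ | i
      · obtain rfl : j = k + 1 := by omega
        obtain ⟨m', hm', e, he, rfl⟩ := mem_succ_nsmul.1 h2
        exact ⟨m₁ + m', ih.2 ⟨0, k, by omega, m₁, h1, m', hm', rfl⟩, e, Or.inr he, by abel⟩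
      · obtain ⟨m', hm', e, he, rfl⟩ := mem_succ_nsmul.1 h1
        exact ⟨m' + m₂, ih.2 ⟨i, j, by omega, m', hm', m₂, h2, rfl⟩, e, Or.inl he, by abel⟩

/-- With no edge between the two parts, a product of edges splits into one for each part; conversely
two such products have disjoint supports, so their product still divides x^a. -/
theorem edgeOrder_union {S S' : Set V} (hS : Disjoint S S')
    (hG : ∀ v ∈ S, ∀ w ∈ S', ¬ G.Adj v w) (a : V →₀ ℕ) :
    edgeOrder G (S ∪ S') a = edgeOrder G S a + edgeOrder G S' a := by
  have hE : edgeExponents G (S ∪ S') = edgeExponents G S ∪ edgeExponents G S' := by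
    ext e
    constructor
    · rintro ⟨v, w, h, hv | hv, hw | hw, rfl⟩
      · exact Or.inl ⟨v, w, h, hv, hw, rfl⟩
      · exact (hG v hv w hw h).elim
      · exact (hG w hw v hv h.symm).elim
      · exact Or.inr ⟨v, w, h, hv, hw, rfl⟩
    · rintro (⟨v, w, h, hv, hw, rfl⟩ | ⟨v, w, h, hv, hw, rfl⟩)
      · exact ⟨v, w, h, Or.inl hv, Or.inl hw, rfl⟩
      · exact ⟨v, w, h, Or.inr hv, Or.inr hw, rfl⟩
  refine eq_of_forall_le_iff fun k => ?_
  rw [← mem_edgePower_iff]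
  constructor
  · rintro ⟨m, hm, hma⟩
    rw [hE, mem_nsmul_union] at hm
    obtain ⟨i, j, rfl, m₁, h1, m₂, h2, rfl⟩ := hm
    exact add_le_add (mem_edgePower_iff.1 ⟨m₁, h1, le_trans (by simp) hma⟩)
      (mem_edgePower_iff.1 ⟨m₂, h2, le_trans (by simp) hma⟩)
  · intro hk
    obtain ⟨m₁, h1, h1a⟩ := mem_edgePower_iff.2 (le_refl (edgeOrder G S a))
    obtain ⟨m₂, h2, h2a⟩ := mem_edgePower_iff.2 (le_refl (edgeOrder G S' a))
    refine antitone_nat_of_succ_le (f := fun k => edgePower G (S ∪ S') k)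
      edgePower_succ_subset hk ⟨m₁ + m₂, ?_, fun v => ?_⟩
    · rw [hE, mem_nsmul_union]
      exact ⟨_, _, rfl, m₁, h1, m₂, h2, rfl⟩
    · rw [Finsupp.add_apply]
      by_cases hv : v ∈ S
      · rw [(le_apply_of_mem_nsmul h2 v).2 (Set.disjoint_left.1 hS hv), add_zero]
        exact h1a v
      · rw [(le_apply_of_mem_nsmul h1 v).2 hv, zero_add]
        exact h2a v

end EdgePowers

/-! ### Vertex covers and weighted König duality -/

section Koenig

variable {V : Type*} {G : SimpleGraph V} {S : Set V}

/-- `W` is a vertex cover of the edges of `G` inside `S`. -/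
def IsCoverOn (G : SimpleGraph V) (S : Set V) (W : Finset V) : Prop :=
  ∀ v w, G.Adj v w → v ∈ S → w ∈ S → v ∈ W ∨ w ∈ W

/-- Weak duality: each edge of the product meets the cover. -/
theorem IsCoverOn.le_sum_of_mem_nsmul {W : Finset V} (hW : IsCoverOn G S W) {k : ℕ}
    {m : V →₀ ℕ} (hm : m ∈ k • edgeExponents G S) : k ≤ ∑ v ∈ W, m v := by
  classical
  induction k generalizing m with
  | zero => simp
  | succ k ih =>
    obtain ⟨m', hm', _, ⟨x, y, hxy, hx, hy, rfl⟩, rfl⟩ := mem_succ_nsmul.1 hm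
    have := ih hm'
    simp only [Finsupp.coe_add, Pi.add_apply, Finset.sum_add_distrib, Finsupp.single_apply,
      Finset.sum_ite_eq]
    rcases hW x y hxy hx hy with h | h <;> simp only [h, if_true] <;> omega

theorem IsCoverOn.le_sum {W : Finset V} (hW : IsCoverOn G S W) {k : ℕ} {a : V →₀ ℕ}
    (ha : a ∈ edgePower G S k) : k ≤ ∑ v ∈ W, a v := by
  obtain ⟨m, hm, hma⟩ := ha
  exact (hW.le_sum_of_mem_nsmul hm).trans (Finset.sum_le_sum fun v _ => hma v)

variable [Fintype V] [DecidableEq V]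

/-- The cover that agrees with `W ∩ W'` on the vertices coloured `true` and with `W ∪ W'` on the
others. -/
def meetCover (c : V → Bool) (W W' : Finset V) : Finset V :=
  Finset.univ.filter fun v => if c v then v ∈ W ∧ v ∈ W' else v ∈ W ∨ v ∈ W'

/-- If the end coloured `true` is missing from one of the two covers, that cover contains the other
end, which therefore lies in the union. -/
theorem IsCoverOn.meet {c : V → Bool} (hc : ∀ v w, G.Adj v w → v ∈ S → w ∈ S → c v ≠ c w)
    {W W' : Finset V} (hW : IsCoverOn G S W) (hW' : IsCoverOn G S W') :
    IsCoverOn G S (meetCover c W W') := by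
  intro v w hvw hv hw
  have h1 := hc v w hvw hv hw
  have h2 := hW v w hvw hv hw
  have h3 := hW' v w hvw hv hw
  cases hcv : c v <;> cases hcw : c w <;> simp_all [meetCover] <;> tauto

/-- Exchanging the colours turns meet into join, so this is modularity of the weight; it makes meet
and join of minimum covers minimum again. -/
theorem sum_meetCover_add (c : V → Bool) (W W' : Finset V) (f : V → ℕ) :
    ∑ v ∈ meetCover c W W', f v + ∑ v ∈ meetCover (fun v => !c v) W W', f v =
      ∑ v ∈ W, f v + ∑ v ∈ W', f v := by
  have key : ∀ U : Finset V, ∑ v ∈ U, f v = ∑ v, if v ∈ U then f v else 0 := by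
    intro U
    simp
  rw [key W, key W', key (meetCover c W W'), key (meetCover _ W W'), ← Finset.sum_add_distrib,
    ← Finset.sum_add_distrib]
  refine Finset.sum_congr rfl fun v _ => ?_
  simp only [meetCover, Finset.mem_filter, Finset.mem_univ, true_and]
  by_cases hcv : c v = true <;> by_cases h : v ∈ W <;> by_cases h' : v ∈ W' <;> simp [hcv, h, h']

/-- If every vertex cover has weight at least `k + 1`, then some edge can be removed such that every
cover of the remaining weights has weight at least `k`. -/
theorem exists_edge_of_forall_lt_sum {c : V → Bool}
    (hc : ∀ v w, G.Adj v w → v ∈ S → w ∈ S → c v ≠ c w) {a : V →₀ ℕ} {k : ℕ}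
    (h : ∀ W, IsCoverOn G S W → k + 1 ≤ ∑ v ∈ W, a v) :
    ∃ x y, G.Adj x y ∧ x ∈ S ∧ y ∈ S ∧ 0 < a x ∧ 0 < a y ∧
      ∀ W, IsCoverOn G S W → x ∈ W → y ∈ W → k + 1 < ∑ v ∈ W, a v := by
  have hc' : ∀ v w, G.Adj v w → v ∈ S → w ∈ S → (!c v) ≠ (!c w) := by
    intro v w hvw hv hw
    simpa using hc v w hvw hv hw
  obtain ⟨x, y, hxy, hx, hy, hax, hay, hcx⟩ : ∃ x y, G.Adj x y ∧ x ∈ S ∧ y ∈ S ∧ 0 < a x ∧ 0 < a y ∧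
      c x = true := by
    by_contra hcon
    push Not at hcon
    -- If no edge had two ends of positive weight, the vertices of weight zero would form a cover of
    -- weight zero.
    have := h (Finset.univ.filter fun v => a v = 0) (by
      intro v w hvw hv hw
      simp only [Finset.mem_filter, Finset.mem_univ, true_and]
      by_contra hno
      rw [not_or] at hno
      have h1 := hcon v w hvw hv hw (by omega) (by omega)
      have h2 := hcon w v hvw.symm hw hv (by omega) (by omega)
      have h3 := hc v w hvw hv hw
      simp_all)
    rw [Finset.sum_eq_zero (by simp)] at this
    omega
  by_cases htight : ∃ W, IsCoverOn G S W ∧ x ∈ W ∧ ∑ v ∈ W, a v = k + 1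
  swap
  · refine ⟨x, y, hxy, hx, hy, hax, hay, fun W hW hxW _ => lt_of_le_of_ne (h W hW) fun he => ?_⟩
    exact htight ⟨W, hW, hxW, he.symm⟩
  -- a tight cover containing `x` with the largest part coloured `false`
  let T : Finset (Finset V) := by
    classical exact Finset.univ.filter fun W => IsCoverOn G S W ∧ x ∈ W ∧ ∑ v ∈ W, a v = k + 1
  have hT : ∀ W, W ∈ T ↔ IsCoverOn G S W ∧ x ∈ W ∧ ∑ v ∈ W, a v = k + 1 := by simp [T]
  obtain ⟨W, hWT, hmax⟩ := T.exists_max_image (fun W => (W.filter fun v => c v = false).card)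
    (by obtain ⟨W, hW⟩ := htight; exact ⟨W, (hT W).2 hW⟩)
  obtain ⟨hW, hxW, hWk⟩ := (hT W).1 hWT
  obtain ⟨z, hxz, hz, haz, hzW⟩ : ∃ z, G.Adj x z ∧ z ∈ S ∧ 0 < a z ∧ z ∉ W := by
    by_contra hcon
    push Not at hcon
    -- Otherwise `x` could be traded for vertices of weight zero, giving a cover lighter than `k +
    -- 1`.
    have hcov := h (W.erase x ∪ Finset.univ.filter fun v => v ∉ W ∧ a v = 0) (by
      intro v w hvw hv hw
      simp only [Finset.mem_union, Finset.mem_erase, Finset.mem_filter, Finset.mem_univ, true_and]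
      have hne := hvw.ne
      by_cases hvx : v = x
      · subst hvx
        have := hcon w hvw hw
        by_cases hwW : w ∈ W
        · exact Or.inr (Or.inl ⟨hne.symm, hwW⟩)
        · exact Or.inr (Or.inr ⟨hwW, by by_contra h0; exact hwW (this (by omega))⟩)
      · by_cases hwx : w = x
        · subst hwx
          have := hcon v hvw.symm hv
          by_cases hvW : v ∈ W
          · exact Or.inl (Or.inl ⟨hne, hvW⟩)
          · exact Or.inl (Or.inr ⟨hvW, by by_contra h0; exact hvW (this (by omega))⟩)
        · rcases hW v w hvw hv hw with h1 | h1
          · exact Or.inl (Or.inl ⟨hvx, h1⟩)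
          · exact Or.inr (Or.inl ⟨hwx, h1⟩))
    have hle : ∑ v ∈ W.erase x ∪ Finset.univ.filter (fun v => v ∉ W ∧ a v = 0), a v ≤
        ∑ v ∈ W.erase x, a v := by
      refine (Finset.sum_union_inter (f := fun v => a v)).le.trans' (Nat.le_add_right _ _) |>.trans ?_
      rw [Finset.sum_eq_zero (s := Finset.univ.filter _) (fun v hv => (Finset.mem_filter.1 hv).2.2),
        add_zero]
    have := Finset.add_sum_erase W (fun v => a v) hxW
    omega
  refine ⟨x, z, hxz, hx, hz, hax, haz, fun W' hW' hxW' hzW' => lt_of_le_of_ne (h W' hW') fun he => ?_⟩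
  have hcz : c z = false := by
    have := hc x z hxz hx hz
    rw [hcx] at this
    simpa using this.symm
  have hm := hW.meet hc hW'
  -- If `W'` were tight and contained `x` and `z`, the meet would be a tight cover containing `x`.
  -- Its `false` part contains that of `W` and also `z`, against maximality.
  have hsum := sum_meetCover_add c W W' a
  have h1 := h _ hm
  have h2 := h _ (hW.meet hc' hW')
  have hmT : meetCover c W W' ∈ T :=
    (hT _).2 ⟨hm, by simp [meetCover, hcx, hxW, hxW'], by omega⟩
  have hlt : (W.filter fun v => c v = false).card <
      ((meetCover c W W').filter fun v => c v = false).card := by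
    refine Finset.card_lt_card ⟨fun v hv => ?_, fun hsub => ?_⟩
    · simp only [Finset.mem_filter] at hv
      simp [meetCover, hv.1, hv.2]
    · have := hsub (x := z) (by simp [meetCover, hcz, hzW'])
      exact hzW (Finset.mem_filter.1 this).1
  exact absurd (hmax _ hmT) (by simpa using hlt)

/-- König's theorem for bipartite graphs with multiplicities on the vertices. -/
theorem mem_edgePower_of_forall_le_sum {c : V → Bool}
    (hc : ∀ v w, G.Adj v w → v ∈ S → w ∈ S → c v ≠ c w) {a : V →₀ ℕ} {k : ℕ}
    (h : ∀ W, IsCoverOn G S W → k ≤ ∑ v ∈ W, a v) : a ∈ edgePower G S k := by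
  induction k generalizing a with
  | zero => simp [edgePower_zero]
  | succ k ih =>
    obtain ⟨x, y, hxy, hx, hy, hax, hay, hlt⟩ := exists_edge_of_forall_lt_sum hc h
    obtain ⟨b, rfl⟩ : ∃ b, a = b + (Finsupp.single x 1 + Finsupp.single y 1) := by
      refine ⟨a - (Finsupp.single x 1 + Finsupp.single y 1), ?_⟩
      rw [tsub_add_cancel_of_le]
      intro v
      have hne := hxy.ne
      simp only [Finsupp.coe_add, Pi.add_apply, Finsupp.single_apply]
      by_cases h1 : x = v
      · subst h1
        simp [hne.symm]
        omega
      · by_cases h2 : y = v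
        · subst h2
          simp [h1]
          omega
        · simp [h1, h2]
    -- Removing the edge costs a cover at most one, or two if it contains both ends, and in that
    -- case the choice of edge left a slack of one.
    obtain ⟨m, hm, hmb⟩ := ih (a := b) fun W hW => by
      have h1 := h W hW
      have h2 := hlt W hW
      simp only [Finsupp.coe_add, Pi.add_apply, Finset.sum_add_distrib, Finsupp.single_apply,
        Finset.sum_ite_eq] at h1 h2
      by_cases hxW : x ∈ W <;> by_cases hyW : y ∈ W <;>
        simp only [hxW, hyW, if_true, if_false, true_imp_iff] at h1 h2 <;> omega
    exact ⟨m + _, mem_succ_nsmul.2 ⟨m, hm, _, ⟨x, y, hxy, hx, hy, rfl⟩, rfl⟩,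
      add_le_add_left hmb _⟩

/-- In a nonempty bipartite graph, every monomial has a variable by whose powers it can be
multiplied without changing its order. -/
theorem exists_edgeOrder_add_single {c : V → Bool}
    (hc : ∀ v w, G.Adj v w → v ∈ S → w ∈ S → c v ≠ c w) (hS : S.Nonempty) (a : V →₀ ℕ) (N : ℕ) :
    ∃ i ∈ S, edgeOrder G S (a + Finsupp.single i N) = edgeOrder G S a := by
  obtain ⟨W, hW, hWa, i, hi, hiW⟩ : ∃ W, IsCoverOn G S W ∧ ∑ v ∈ W, a v ≤ edgeOrder G S a ∧
      ∃ i ∈ S, i ∉ W := by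
    obtain ⟨W, hW, hWa⟩ : ∃ W, IsCoverOn G S W ∧ ∑ v ∈ W, a v ≤ edgeOrder G S a := by
      by_contra hcon
      push Not at hcon
      have := mem_edgePower_iff.1
        (mem_edgePower_of_forall_le_sum (k := edgeOrder G S a + 1) hc fun W hW => hcon W hW)
      omega
    by_cases hSW : ∃ i ∈ S, i ∉ W
    · exact ⟨W, hW, hWa, hSW⟩
    push Not at hSW
    obtain ⟨i, hi⟩ := hS
    -- When `W` contains all of `S`, keeping only the colour opposite to `i` still leaves a cover.
    refine ⟨W.filter fun v => c v ≠ c i, fun v w hvw hv hw => ?_,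
      (Finset.sum_le_sum_of_subset (Finset.filter_subset _ _)).trans hWa, i, hi, by simp⟩
    have := hc v w hvw hv hw
    simp only [Finset.mem_filter, hSW v hv, hSW w hw, true_and]
    by_contra hno
    rw [not_or, not_not, not_not] at hno
    exact this (hno.1.trans hno.2.symm)
  -- The cover misses `i`, so its weight still bounds the order after the exponent at `i` is raised.
  refine ⟨i, hi, le_antisymm ?_ ?_⟩
  · refine (hW.le_sum (mem_edgePower_iff.2 le_rfl)).trans (le_trans (le_of_eq ?_) hWa)
    refine Finset.sum_congr rfl fun v hv => ?_
    have : i ≠ v := by rintro rfl; exact hiW hv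
    simp [this]
  · exact mem_edgePower_iff.1
      (isUpperSet_edgePower _ (by simp) (mem_edgePower_iff.2 (le_refl (edgeOrder G S a))))

end Koenig

/-! ### Assembling the connected components -/

section Components

variable {V : Type*} [Fintype V] [DecidableEq V]

open Classical in
theorem boxPartition_edgeOrder_component (G : SimpleGraph V) (D : G.ConnectedComponent) (k : ℕ) :
    BoxPartition (Finset.univ.filter (· ∈ D.supp)) (if D.toSimpleGraph.IsBipartite then 1 else 0)
      {a | edgeOrder G D.supp a = k} := by
  set C : Finset V := Finset.univ.filter (· ∈ D.supp) with hC
  have hCD : (C : Set V) = D.supp := by ext; simp [hC]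
  rw [← hCD]
  split_ifs with hbip
  · obtain ⟨f⟩ := hbip
    let c : V → Bool := fun v => if hv : v ∈ D.supp then decide (f ⟨v, hv⟩ = 0) else false
    have hc : ∀ v w, G.Adj v w → v ∈ (C : Set V) → w ∈ (C : Set V) → c v ≠ c w := by
      rw [hCD]
      intro v w hvw hv hw
      have hne : f ⟨v, hv⟩ ≠ f ⟨w, hw⟩ := f.valid hvw
      simp only [c, hv, hw, dif_pos]
      intro heq
      rw [decide_eq_decide] at heq
      omega
    refine (edgeOrder_determinedBy k).boxPartition_one (ordConnected_edgeOrder k) ?_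
    rintro a rfl
    exact exists_edgeOrder_add_single hc (hCD ▸ D.nonempty_supp) a _
  · exact (edgeOrder_determinedBy k).boxPartition_zero

theorem boxPartition_edgeOrder (G : SimpleGraph V) (k : ℕ) :
    BoxPartition Finset.univ (numBipartiteComponents G)
      {a | edgeOrder G Set.univ a = k} := by
  classical
  have := Fintype.ofFinite G.ConnectedComponent
  -- All orders are treated at once, since adding a component of order `j` calls for order `k - j`
  -- on the others.
  have key : ∀ (T : Finset G.ConnectedComponent) (k : ℕ),
      BoxPartition (Finset.univ.filter fun v => G.connectedComponentMk v ∈ T)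
        (∑ D ∈ T, if D.toSimpleGraph.IsBipartite then 1 else 0)
        {a | edgeOrder G {v | G.connectedComponentMk v ∈ T} a = k} := by
    intro T
    induction T using Finset.induction_on with
    | empty =>
      intro k
      have hS : {v | G.connectedComponentMk v ∈ (∅ : Finset G.ConnectedComponent)} =
          ((∅ : Finset V) : Set V) := by ext; simp
      rw [hS, Finset.sum_empty]
      simpa using (edgeOrder_determinedBy (G := G) (C := ∅) k).boxPartition_zero
    | insert D T hD ih =>
      intro k
      have hset : {v | G.connectedComponentMk v ∈ insert D T} =
          D.supp ∪ {v | G.connectedComponentMk v ∈ T} := by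
        ext v
        simp [SimpleGraph.ConnectedComponent.mem_supp_iff]
      have hdisj : Disjoint D.supp {v | G.connectedComponentMk v ∈ T} := by
        refine Set.disjoint_left.2 fun v hv hv' => hD ?_
        rw [SimpleGraph.ConnectedComponent.mem_supp_iff] at hv
        rw [← hv]
        exact hv'
      have hadj : ∀ v ∈ D.supp, ∀ w ∈ {v | G.connectedComponentMk v ∈ T}, ¬ G.Adj v w := by
        intro v hv w hw hvw
        refine Set.disjoint_left.1 hdisj hv ?_
        have := SimpleGraph.ConnectedComponent.connectedComponentMk_eq_of_adj hvw
        simp only [Set.mem_ofPred_eq] at hw ⊢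
        rwa [this]
      have hfin : (Finset.univ.filter fun v => G.connectedComponentMk v ∈ insert D T) =
          (Finset.univ.filter (· ∈ D.supp)) ∪
            Finset.univ.filter fun v => G.connectedComponentMk v ∈ T := by
        ext v
        simp [SimpleGraph.ConnectedComponent.mem_supp_iff]
      have hUnion : {a | edgeOrder G {v | G.connectedComponentMk v ∈ insert D T} a = k} =
          ⋃ j ∈ Finset.range (k + 1), {a | edgeOrder G D.supp a = j} ∩
            {a | edgeOrder G {v | G.connectedComponentMk v ∈ T} a = k - j} := by
        ext a
        rw [hset]
        simp only [edgeOrder_union hdisj hadj, Set.mem_iUnion, Set.mem_inter_iff,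
          Set.mem_ofPred_eq, Finset.mem_range, exists_prop]
        constructor
        · rintro rfl
          exact ⟨_, by omega, rfl, by omega⟩
        · rintro ⟨j, hj, h1, h2⟩
          omega
      rw [hUnion, hfin, Finset.sum_insert hD]
      refine .biUnion _ _ (fun j _ => ?_) fun i _ j _ hij => ?_
      · refine (boxPartition_edgeOrder_component G D j).inter ?_ (ih _)
        refine Finset.disjoint_left.2 fun v hv hv' => ?_
        exact Set.disjoint_left.1 hdisj (Finset.mem_filter.1 hv).2 (Finset.mem_filter.1 hv').2
      · exact Set.disjoint_left.2 fun a ha hb => hij (ha.1.symm.trans hb.1)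
  have h := key Finset.univ k
  have hS : {v | G.connectedComponentMk v ∈ (Finset.univ : Finset G.ConnectedComponent)} =
      Set.univ := by ext; simp
  rw [hS] at h
  have hcard : (∑ D : G.ConnectedComponent, if D.toSimpleGraph.IsBipartite then 1 else 0) =
      numBipartiteComponents G := by
    rw [numBipartiteComponents, Nat.card_eq_fintype_card, Fintype.card_subtype,
      Finset.card_filter]
  rw [hcard] at h
  simpa using h

end Components

/-! ### From box partitions to Stanley decompositions -/

section MonomialIdeals

variable {V K : Type*} [Field K]

theorem support_subset_of_mem_supported {Z : Finset V} {f : MvPolynomial V K}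
    (hf : f ∈ supported K (Z : Set V)) {b : V →₀ ℕ} (hb : b ∈ f.support) : b.support ⊆ Z := by
  intro v hv
  exact_mod_cast (mem_supported.1 hf) (by exact_mod_cast (mem_vars_iff_mem_support v).2 ⟨b, hb, hv⟩)

theorem span_monomial_image_mul (A B : Set (V →₀ ℕ)) :
    Ideal.span ((fun s => monomial s (1 : K)) '' A) * Ideal.span ((fun s => monomial s (1 : K)) '' B)
      = Ideal.span ((fun s => monomial s (1 : K)) '' (A + B)) := by
  rw [Ideal.span_mul_span']
  congr 1
  ext f
  simp only [Set.mem_mul, Set.mem_image, Set.mem_add]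
  constructor
  · rintro ⟨_, ⟨a, ha, rfl⟩, _, ⟨b, hb, rfl⟩, rfl⟩
    exact ⟨a + b, ⟨a, ha, b, hb, rfl⟩, by simp [monomial_mul]⟩
  · rintro ⟨_, ⟨a, ha, b, hb, rfl⟩, rfl⟩
    exact ⟨_, ⟨a, ha, rfl⟩, _, ⟨b, hb, rfl⟩, by simp [monomial_mul]⟩

theorem edgeIdeal_pow_eq_span (G : SimpleGraph V) (k : ℕ) : edgeIdeal K G ^ k =
    Ideal.span ((fun s => monomial s (1 : K)) '' (k • edgeExponents G Set.univ)) := by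
  have h1 : edgeIdeal K G =
      Ideal.span ((fun s => monomial s (1 : K)) '' (edgeExponents G Set.univ)) := by
    unfold edgeIdeal
    congr 1
    ext f
    constructor
    · rintro ⟨v, w, h, rfl⟩
      exact ⟨_, ⟨v, w, h, trivial, trivial, rfl⟩, by simp [X, monomial_mul]⟩
    · rintro ⟨_, ⟨v, w, h, _, _, rfl⟩, rfl⟩
      exact ⟨v, w, h, by simp [X, monomial_mul]⟩
  induction k with
  | zero =>
    rw [pow_zero, zero_nsmul, Ideal.one_eq_top]
    symm
    rw [Ideal.eq_top_iff_one]
    exact Ideal.subset_span ⟨0, by simp, rfl⟩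
  | succ k ih => rw [pow_succ, succ_nsmul, ← span_monomial_image_mul, ← ih, ← h1]

theorem mem_edgeIdeal_pow_iff (G : SimpleGraph V) (k : ℕ) (f : MvPolynomial V K) :
    f ∈ edgeIdeal K G ^ k ↔ ∀ a ∈ f.support, a ∈ edgePower G Set.univ k := by
  rw [edgeIdeal_pow_eq_span, mem_ideal_span_monomial_image]
  rfl

/-- A partition into boxes of the exponents of the monomials in `J` but not in `L` yields a Stanley
decomposition of `J / L`, for monomial ideals `J` and `L`. -/
theorem le_sdepth_of_boxPartition [Fintype V] {J L : Ideal (MvPolynomial V K)}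
    {P Q : Set (V →₀ ℕ)} (hJ : ∀ f, f ∈ J ↔ ∀ a ∈ f.support, a ∈ P)
    (hL : ∀ f, f ∈ L ↔ ∀ a ∈ f.support, a ∈ Q) {d : ℕ}
    (hd : BoxPartition Finset.univ d (P \ Q)) : (d : ℕ∞) ≤ sdepth (quotGrading J L) := by
  classical
  obtain ⟨r, u, Z, hZ, hsub, hcov, hdisj⟩ := hd.exists_boxes
  have hmon : ∀ a ∈ P, ∀ t : K, monomial a t ∈ J := by
    intro a ha t
    refine (hJ _).2 fun b hb => ?_
    rwa [Finset.mem_singleton.1 (support_monomial_subset hb)]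
  have huP : ∀ i, u i ∈ P := fun i => by simpa using (hsub i 0 (by simp)).1
  let e : Fin r → J := fun i => ⟨monomial (u i) 1, hmon _ (huP i) 1⟩
  let U : Fin r → IdealQuot J L := fun i => Submodule.Quotient.mk (e i)
  have hzero : ∀ x : J, (Submodule.Quotient.mk x : IdealQuot J L) = 0 ↔ (x : MvPolynomial V K) ∈ L :=
    fun x => Submodule.Quotient.mk_eq_zero _
  -- This gives both freeness and directness. By disjointness of the boxes, the coefficient at `u i
  -- + b` comes from the `i`-th term alone, and that exponent is not in `Q`.
  have hindep : ∀ f : Fin r → MvPolynomial V K, (∀ i, f i ∈ supported K (Z i : Set V)) →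
      ∑ i, f i • U i = 0 → ∀ i, f i = 0 := by
    intro f hf hsum i
    have hmem : ∑ j, f j * monomial (u j) 1 ∈ L := by
      have h1 : ∑ j, f j • U j = Submodule.Quotient.mk (∑ j, f j • e j) := by
        simp only [U]
        rw [← Submodule.mkQ_apply, map_sum]
        rfl
      rw [h1, hzero] at hsum
      simpa [e] using hsum
    by_contra hne
    obtain ⟨b, hb⟩ := support_nonempty.2 hne
    have hbZ := support_subset_of_mem_supported (hf i) hb
    refine (hsub i b hbZ).2 ((hL _).1 hmem _ ?_)
    rw [mem_support_iff, coeff_sum, Finset.sum_eq_single i, add_comm, coeff_mul_monomial, mul_one]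
    · exact mem_support_iff.1 hb
    · intro j _ hji
      rw [coeff_mul_monomial']
      split_ifs with hle
      · rw [mul_one]
        by_contra hc
        exact hji (hdisj j i _ b (support_subset_of_mem_supported (hf j) (mem_support_iff.2 hc)) hbZ
          (add_tsub_cancel_of_le hle))
      · rfl
    · simp
  have hsingle : ∀ i, ∀ f ∈ supported K (Z i : Set V), f • U i = 0 → f = 0 := by
    intro i f hf h0
    have := hindep (Pi.single i f) (fun j => by
      by_cases hji : j = i
      · subst hji; simpa using hf
      · simp [hji]) (by
      rw [Finset.sum_eq_single i (fun j _ hj => by simp [hj]) (by simp)]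
      simpa using h0) i
    simpa using this
  have hinternal : DirectSum.IsInternal fun i => stanleySpace (K := K) (U i) (Z i) := by
    refine DirectSum.isInternal_submodule_of_iSupIndep_of_iSup_eq_top ?_ ?_
    · refine iSupIndep_of_dfinsupp_lsum_injective _ ((injective_iff_map_eq_zero _).2 fun w hw => ?_)
      have hex : ∀ i, ∃ f ∈ supported K (Z i : Set V), f • U i = (w i : IdealQuot J L) :=
        fun i => (w i).2
      choose f hf hfw using hex
      have hs : ∑ i, f i • U i = 0 := by
        rw [← hw, DFinsupp.lsum_apply_apply, DFinsupp.sumAddHom_apply,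
          DFinsupp.sum_eq_sum_fintype _ (by simp)]
        exact Finset.sum_congr rfl fun i _ => hfw i
      ext i
      rw [← hfw i, hindep f hf hs i]
      simp
    · refine eq_top_iff.2 fun x _ => ?_
      obtain ⟨⟨g, hg⟩, rfl⟩ := Submodule.Quotient.mk_surjective _ x
      have hgP := (hJ g).1 hg
      -- Spanning is checked on monomials: those with exponent in `Q` vanish in the quotient, the
      -- others lie in a box.
      have hsum : (⟨g, hg⟩ : J) = ∑ a ∈ g.support.attach,
          ⟨monomial a.1 (g.coeff a.1), hmon _ (hgP _ a.2) _⟩ := by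
        ext1
        rw [AddSubmonoidClass.coe_finsetSum]
        simp only
        rw [Finset.sum_attach g.support fun a => monomial a (g.coeff a)]
        exact g.as_sum
      rw [hsum, ← Submodule.mkQ_apply, map_sum]
      refine Submodule.sum_mem _ fun a _ => ?_
      by_cases haQ : a.1 ∈ Q
      · have : (Submodule.comap J.subtype L).mkQ
            ⟨monomial a.1 (g.coeff a.1), hmon _ (hgP _ a.2) _⟩ = 0 := by
          refine (hzero _).2 ((hL _).2 fun b hb => ?_)
          rwa [Finset.mem_singleton.1 (support_monomial_subset hb)]
        rw [this]
        exact Submodule.zero_mem _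
      · obtain ⟨i, b, hb, hab⟩ := hcov a.1 ⟨hgP _ a.2, haQ⟩
        refine Submodule.mem_iSup_of_mem i ⟨monomial b (g.coeff a.1), ?_, ?_⟩
        · refine mem_supported.2 fun v hv => ?_
          obtain ⟨c, hc, hvc⟩ := (mem_vars_iff_mem_support v).1 hv
          rw [Finset.mem_singleton.1 (support_monomial_subset hc)] at hvc
          exact hb hvc
        · change (Submodule.Quotient.mk (monomial b (g.coeff a.1) • e i) : IdealQuot J L) = _
          congr 1
          ext1
          simp [e, monomial_mul, hab, add_comm]
  let D : StanleyDecomposition (quotGrading J L) :=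
    { r := r
      u := U
      Z := Z
      homogeneous := fun i => ⟨_, e i, isWeightedHomogeneous_monomial _ (u i) 1 rfl, rfl⟩
      free := hsingle
      isInternal := hinternal }
  exact le_iSup_of_le D (le_iInf fun i => by exact_mod_cast hZ i)

end MonomialIdeals

theorem theorem2p2 {K : Type*} [Field K] {V : Type*} [Finite V] (G : SimpleGraph V) (k : ℕ) :
    (numBipartiteComponents G : ℕ∞) ≤
      sdepth (quotGrading (edgeIdeal K G ^ k) (edgeIdeal K G ^ (k + 1))) := by
  classical
  have := Fintype.ofFinite V
  refine le_sdepth_of_boxPartition (mem_edgeIdeal_pow_iff G k) (mem_edgeIdeal_pow_iff G (k + 1)) ?_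
  convert boxPartition_edgeOrder G k using 1
  ext a
  exact edgeOrder_eq_iff.symm
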